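/- **Setting (extended stochastic ball model).** Let $m,k\ge 1$ be integers. For $i\in[k]=\{1,\dots,k\}$ let $c_i\in\mathbb R^m$, $r_i>0$, $\beta_i\ge 1$, and let $\mu_i$ be a probability measure on the closed Euclidean ball $B_i=B^m_{r_i}(c_i)$. Write $d$ for the Euclidean distance, $t_+=\max\{t,0\}$, $$E_i=\int d(x,c_i)\,d\mu_i(x),\qquad D_i=\min\{d(c_i,c_j)-r_i \mid j\in[k],\ j\ne i\}\quad(D_i=+\infty\text{ if }k=1).$$ For a positive integer $n$ such that every $n_i:=\beta_i n$ is an integer, draw independent points $x^{(i)}_\ell$, $i\in[k]$, $\ell\in[n_i]$, where $x^{(i)}_\ell$ has law $\mu_i$, and let $P$ be the family of all these points. For $\alpha\in\mathbb R^k$ and $z\in\mathbb R^m$ let $$C^\alpha(z)=\sum_{i\in[k]}\sum_{\ell\in[n_i]}(\alpha_i-d(z,x^{(i)}_\ell))_+,\qquad G^\alpha(z)=\frac1n\,\mathbb E\,C^\alpha(z)=\sum_{i\in[k]}\beta_i\int(\alpha_i-d(z,x))_+\,d\mu_i(x).$$ The $k$-median linear program (LP) is $$\min\sum_{p,q\in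 P}d(p,q)z_{pq}\quad\text{s.t.}\quad \sum_{p\in P}z_{pq}=1\ \ \forall q\in P,\qquad z_{pq}\le y_p\ \ \forall p,q\in P,\qquad \sum_{p\in P}y_p=k,\qquad y_p,z_{pq}\ge0\ \ \forall p,q\in P,$$ and (IP) is the same problem with $y_p,z_{pq}\in\{0,1\}$. The (LP) *achieves exact recovery* if it has a unique optimal solution, this solution is feasible for (IP), and it assigns each point to the ball from which it is drawn (that is, $z_{pq}=1$ only if $p$ and $q$ are drawn from the same ball). **Theorem.** Assume that for every $i\in[k]$: 1. $\mu_i$ is invariant under rotations centered in $c_i$; 2. every (relatively) open subset of $B_i$ containing $c_i$ has positive $\mu_i$-measure; 3. every subset of $B_i$ of Lebesgue measure zero has $\mu_i$-measure zero. Assume that $\gamma\in\mathbb R$ satisfies $$\max_{i\in[k]}\beta_i(r_i-E_i)<\gamma<\min_{i\in[k]}\beta_i(D_i-E_i),$$ let $\alpha_i:=E_i+\gamma/\beta_i$ for $i\in[k]$, and assume that for every $i\in[k]$ the point $c_i$ is the unique maximizer of $G^\alpha$ over $B_i$. Then (LP) achieves exact recovery with high probability, where, if $m=1$, only those $n$ are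 considered for which all the sample sizes $n_i$ are odd. That is, for every $\delta\in(0,1)$ there is $n_0$ such that for every $n>n_0$ for which all $n_i=\beta_i n$ are integers (all odd integers if $m=1$), the probability that (LP) achieves exact recovery is greater than $1-\delta$. -/

import Mathlib

open MeasureTheory

noncomputable section

namespace KMedian

/-! ## The integer program and its linear relaxation

The data points are indexed by a finite type `ι`, and `d p q` is the distance between the points
with indices `p` and `q`. -/

/-- Feasible solutions `(y, z)` of the linear relaxation of the `k`-median problem. -/
structure LPFeasible {ι : Type*} [Fintype ι] (k : ℕ) (y : ι → ℝ) (z : ι → ι → ℝ) : Prop where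
  assign : ∀ q, ∑ p, z p q = 1
  le_open : ∀ p q, z p q ≤ y p
  count : ∑ p, y p = k
  y_nonneg : ∀ p, 0 ≤ y p
  z_nonneg : ∀ p q, 0 ≤ z p q

/-- Feasible solutions `(y, z)` of the integer program for the `k`-median problem. -/
structure IPFeasible {ι : Type*} [Fintype ι] (k : ℕ) (y : ι → ℝ) (z : ι → ι → ℝ) : Prop where
  assign : ∀ q, ∑ p, z p q = 1
  le_open : ∀ p q, z p q ≤ y p
  count : ∑ p, y p = k
  y_binary : ∀ p, y p = 0 ∨ y p = 1
  z_binary : ∀ p q, z p q = 0 ∨ z p q = 1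

/-- The common objective function. -/
def cost {ι : Type*} [Fintype ι] (d : ι → ι → ℝ) (z : ι → ι → ℝ) : ℝ :=
  ∑ p, ∑ q, d p q * z p q

/-- `(y, z)` is an optimal solution of the linear program. -/
def LPOptimal {ι : Type*} [Fintype ι] (k : ℕ) (d : ι → ι → ℝ)
    (y : ι → ℝ) (z : ι → ι → ℝ) : Prop :=
  LPFeasible k y z ∧ ∀ y' z', LPFeasible k y' z' → cost d z ≤ cost d z'

/-- The linear program achieves exact recovery of the clustering in which the point with index `p`
comes from the cluster `label p`: it has a unique optimal solution, this solution is feasible for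
the integer program, and it assigns every point to its own cluster, that is, points are only
assigned to centers from the cluster they come from. -/
def ExactRecovery {ι κ : Type*} [Fintype ι] (k : ℕ) (d : ι → ι → ℝ) (label : ι → κ) : Prop :=
  ∃ (y : ι → ℝ) (z : ι → ι → ℝ),
    LPOptimal k d y z ∧
    (∀ y' z', LPOptimal k d y' z' → y' = y ∧ z' = z) ∧
    IPFeasible k y z ∧
    ∀ p q, z p q = 1 → label p = label q

/-! ## The extended stochastic ball model -/

/-- The parameters of the extended stochastic ball model: `k` closed balls in `ℝ^m`, a probability
measure on each of them, and the numbers `β i ≥ 1` that fix the proportions of the sample sizes. -/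
structure ESBM (k m : ℕ) where
  c : Fin k → EuclideanSpace ℝ (Fin m)
  r : Fin k → ℝ
  r_pos : ∀ i, 0 < r i
  μ : Fin k → Measure (EuclideanSpace ℝ (Fin m))
  isProbabilityMeasure : ∀ i, IsProbabilityMeasure (μ i)
  μ_compl_ball : ∀ i, μ i (Metric.closedBall (c i) (r i))ᶜ = 0
  β : Fin k → ℝ
  one_le_β : ∀ i, 1 ≤ β i

namespace ESBM

variable {k m : ℕ} (M : ESBM k m)

/-- `μ i` is invariant under all rotations (elements of `SO(m)`) centered at `c i`. -/
def RotationInvariant (i : Fin k) : Prop :=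
  ∀ Q : EuclideanSpace ℝ (Fin m) ≃ₗᵢ[ℝ] EuclideanSpace ℝ (Fin m),
    LinearMap.det (Q.toLinearEquiv : EuclideanSpace ℝ (Fin m) →ₗ[ℝ] EuclideanSpace ℝ (Fin m)) = 1 →
    (M.μ i).map (fun x => M.c i + Q (x - M.c i)) = M.μ i

/-- Every (relatively) open subset of the ball that contains the center has positive measure. -/
def PositiveNearCenter (i : Fin k) : Prop :=
  ∀ U : Set (EuclideanSpace ℝ (Fin m)), IsOpen U → M.c i ∈ U →
    0 < M.μ i (U ∩ Metric.closedBall (M.c i) (M.r i))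

/-- `E i` is the expected distance of a point drawn according to `μ i` from the center `c i`. -/
def E (i : Fin k) : ℝ := ∫ x, dist x (M.c i) ∂(M.μ i)

/-- `D i = min {d(c i, c j) - r i | j ≠ i}`, which is `⊤` (no condition) if there is no `j ≠ i`. -/
def D (i : Fin k) : EReal :=
  ⨅ j : {j : Fin k // j ≠ i}, ((dist (M.c i) (M.c j) - M.r i : ℝ) : EReal)

/-- The joint law of the independent points `x (i, ℓ)`, for `i ∈ [k]` and `ℓ ∈ [N i]`, where
`x (i, ℓ)` is drawn according to `μ i`. -/
def sampleLaw (N : Fin k → ℕ) :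
    Measure ((Σ i : Fin k, Fin (N i)) → EuclideanSpace ℝ (Fin m)) :=
  Measure.pi fun p => M.μ p.1

/-- The contribution function `C^α(z)` of a sample `x`. -/
def contribution {N : Fin k → ℕ} (α : Fin k → ℝ)
    (x : (Σ i : Fin k, Fin (N i)) → EuclideanSpace ℝ (Fin m))
    (z : EuclideanSpace ℝ (Fin m)) : ℝ :=
  ∑ i, ∑ l : Fin (N i), max (α i - dist z (x ⟨i, l⟩)) 0

/-- The function `G^α(z) = (1/n) 𝔼 C^α(z)`, written without reference to `n`;
see `G_eq_expected_contribution`. -/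
def G (α : Fin k → ℝ) (z : EuclideanSpace ℝ (Fin m)) : ℝ :=
  ∑ i, M.β i * ∫ x, max (α i - dist z x) 0 ∂(M.μ i)

/-- `G^α(z)` is `1/n` times the expected contribution, for every `n ≥ 1` for which the sample sizes
`N i = β i * n` make sense. -/
theorem G_eq_expected_contribution (α : Fin k → ℝ) (z : EuclideanSpace ℝ (Fin m))
    {n : ℕ} (hn : 0 < n) (N : Fin k → ℕ) (hN : ∀ i, (N i : ℝ) = M.β i * n) :
    M.G α z = 1 / (n : ℝ) * ∫ x, contribution (N := N) α x z ∂(M.sampleLaw N) := by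
  have := M.isProbabilityMeasure
  have hint : ∀ i, Integrable (fun x => max (α i - dist z x) 0) (M.μ i) := by
    intro i
    refine Integrable.of_bound (C := max (α i) 0)
      (by fun_prop : Continuous fun x => max (α i - dist z x) 0).aestronglyMeasurable
      (Filter.Eventually.of_forall fun x => ?_)
    rw [Real.norm_of_nonneg (le_max_right _ _)]
    exact max_le_max (by linarith [dist_nonneg (x := z) (y := x)]) le_rfl
  have hmp : ∀ p : (Σ i : Fin k, Fin (N i)),
      MeasurePreserving (Function.eval p) (M.sampleLaw N) (M.μ p.1) := fun p =>
    measurePreserving_eval (fun p : (Σ i : Fin k, Fin (N i)) => M.μ p.1) p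
  have hi : ∀ i (l : Fin (N i)), Integrable
      (fun x : (Σ i : Fin k, Fin (N i)) → EuclideanSpace ℝ (Fin m) =>
        max (α i - dist z (x ⟨i, l⟩)) 0) (M.sampleLaw N) := fun i l =>
    (hmp ⟨i, l⟩).integrable_comp_of_integrable (hint i)
  have he : ∀ i (l : Fin (N i)),
      ∫ x, max (α i - dist z (x ⟨i, l⟩)) 0 ∂(M.sampleLaw N)
        = ∫ x, max (α i - dist z x) 0 ∂(M.μ i) := by
    intro i l
    have h := (hmp ⟨i, l⟩).map_eq
    have h2 := integral_map (μ := M.sampleLaw N) (hmp ⟨i, l⟩).measurable.aemeasurable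
      (f := fun x => max (α i - dist z x) 0) (by rw [h]; exact (hint i).aestronglyMeasurable)
    rw [h] at h2
    exact h2.symm
  unfold contribution G
  rw [integral_finsetSum _ fun i _ => integrable_finsetSum _ fun l _ => hi i l, Finset.mul_sum]
  refine Finset.sum_congr rfl fun i _ => ?_
  rw [integral_finsetSum _ fun l _ => hi i l]
  simp only [he, Finset.sum_const, Finset.card_univ, Fintype.card_fin, nsmul_eq_mul, hN]
  have : (n : ℝ) ≠ 0 := by positivity
  field_simp

end ESBM

end KMedian

end

/-!
The proof exhibits a dual solution of the linear program that certifies exact recovery. The dual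
program asks for numbers `a q` and `w` with `∑ q, max (a q - d p q) 0 ≤ w` for all `p`, and
maximizes `∑ q, a q - k * w`. If `a q = a (label q)` depends on the cluster only, then the left-hand
side is the contribution function `C^a(x p)` of the sample. By complementary slackness
(`exactRecovery_of_dual`), it suffices that `C^a` takes its maximum `w` over the sample at exactly
one point `x (s i)` of each cluster, and that the ball of radius `a i` around the point `x (s j)`
contains the `i`-th cluster if `i = j` and no point of it otherwise.

By the choice of `α`, the function `G^α` has the same value `γ` at all the centers `c i`
(`ESBM.G_center`), and by assumption it is smaller elsewhere on the balls. The sample contributions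
follow `n * G^α`: pointwise by Chebyshev's inequality (`ESBM.withHighProbability_contribution`), and
uniformly on the compact set of points at distance at least `ρ` from the center of their ball
(`ESBM.withHighProbability_contribution_le`). So `C^α` is smaller than `n * γ` by a linear margin
there. Close to `c i`, only the `i`-th cluster contributes and no positive part is active, so
`C^a` is a constant minus the sum of the distances to the `i`-th cluster. One takes for `s i` the
minimizer of this sum among the sample points close to `c i`, puts `w = n * γ`, and solves
`C^a(x (s i)) = w` for `a i`; the result is close to `α i`
(`ESBM.exactRecovery_of_concentration`).

It remains to see that this minimizer is almost surely unique (`ae_injOn_sum_dist`). A tie between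
two sample points `p` and `p'` forces every third one onto a level set of `dist p · - dist p' ·`.
Such a set is a Lebesgue null set, because the function is strictly monotone in the direction
`p' - p` off the line through `p` and `p'`
(`addHaar_dist_sub_dist_level_eq_zero`). In dimension one this line is the whole space, and a parity
argument takes over.
-/

namespace KMedian

open MeasureTheory ProbabilityTheory Filter

/-! ### A dual certificate for exact recovery -/

/-- A dual certificate for exact recovery. The numbers `a q` are the dual variables of the
assignment constraints, `w` is the one of the constraint on the number of centers, and the values
`max (a q - d p q) 0` are those of the constraints `z p q ≤ y p`. The strict inequalities and
complementary slackness force every optimal solution to be the integral one with centers `s i`. -/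
theorem exactRecovery_of_dual {ι : Type*} [Fintype ι] {k : ℕ} (d : ι → ι → ℝ)
    (label : ι → Fin k) (s : Fin k → ι) (hs : ∀ i, label (s i) = i) (a : ι → ℝ) (w : ℝ)
    (hown : ∀ q, d (s (label q)) q ≤ a q)
    (hother : ∀ i q, i ≠ label q → a q < d (s i) q)
    (hcenter : ∀ i, ∑ q, max (a q - d (s i) q) 0 = w)
    (hnoncenter : ∀ p, (∀ i, s i ≠ p) → ∑ q, max (a q - d p q) 0 < w) :
    ExactRecovery k d label := by
  classical
  have hinj : Function.Injective s := Function.LeftInverse.injective hs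
  have hle : ∀ p, ∑ q, max (a q - d p q) 0 ≤ w := fun p => by
    by_cases h : ∃ i, s i = p
    · obtain ⟨i, rfl⟩ := h
      exact (hcenter i).le
    · exact (hnoncenter p (fun i hi => h ⟨i, hi⟩)).le
  -- The slack in weak duality, as a sum of non-negative terms.
  have hslack : ∀ y z, LPFeasible k y z →
      cost d z - (∑ q, a q - k * w) =
        ∑ p, (∑ q, (max (d p q - a q) 0 * z p q + max (a q - d p q) 0 * (y p - z p q))
          + y p * (w - ∑ q, max (a q - d p q) 0)) := by
    intro y z h
    have h1 : ∑ q, a q = ∑ p, ∑ q, a q * z p q := by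
      rw [Finset.sum_comm]
      refine Finset.sum_congr rfl fun q _ => ?_
      rw [← Finset.mul_sum, h.assign, mul_one]
    have h2 : (k : ℝ) * w = ∑ p, y p * w := by rw [← Finset.sum_mul, h.count]
    rw [cost, h1, h2, ← Finset.sum_sub_distrib, ← Finset.sum_sub_distrib]
    refine Finset.sum_congr rfl fun p _ => ?_
    have h3 : ∑ q, (max (d p q - a q) 0 * z p q + max (a q - d p q) 0 * (y p - z p q)) =
        ∑ q, d p q * z p q - ∑ q, a q * z p q + y p * ∑ q, max (a q - d p q) 0 := by
      rw [Finset.mul_sum, ← Finset.sum_sub_distrib, ← Finset.sum_add_distrib]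
      refine Finset.sum_congr rfl fun q _ => ?_
      rcases le_total (d p q) (a q) with hdq | hdq
      · rw [max_eq_right (by linarith), max_eq_left (by linarith)]; ring
      · rw [max_eq_left (by linarith), max_eq_right (by linarith)]; ring
    rw [h3]; ring
  have hterm1 : ∀ y z, LPFeasible k y z → ∀ p q,
      0 ≤ max (d p q - a q) 0 * z p q + max (a q - d p q) 0 * (y p - z p q) := fun y z h p q =>
    add_nonneg (mul_nonneg (le_max_right _ _) (h.z_nonneg p q))
      (mul_nonneg (le_max_right _ _) (sub_nonneg.2 (h.le_open p q)))
  have hterm2 : ∀ y z, LPFeasible k y z → ∀ p,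
      0 ≤ y p * (w - ∑ q, max (a q - d p q) 0) := fun y z h p =>
    mul_nonneg (h.y_nonneg p) (sub_nonneg.2 (hle p))
  have hlow : ∀ y z, LPFeasible k y z → ∑ q, a q - k * w ≤ cost d z := by
    intro y z h
    rw [← sub_nonneg, hslack y z h]
    exact Finset.sum_nonneg fun p _ => add_nonneg (Finset.sum_nonneg fun q _ => hterm1 y z h p q)
      (hterm2 y z h p)
  let y₀ : ι → ℝ := fun p => if ∃ i, s i = p then 1 else 0
  let z₀ : ι → ι → ℝ := fun p q => if s (label q) = p then 1 else 0
  have hIP : IPFeasible k y₀ z₀ := by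
    refine ⟨fun q => by simp [z₀], fun p q => ?_, ?_, fun p => ?_, fun p q => ?_⟩
    · simp only [y₀, z₀]
      split_ifs with h1 h2 h2
      · rfl
      · exact absurd ⟨_, h1⟩ h2
      · exact zero_le_one
      · rfl
    · simp only [y₀, Finset.sum_boole]
      have : Finset.univ.filter (fun p => ∃ i, s i = p) = Finset.univ.image s := by
        ext p; simp
      rw [this, Finset.card_image_of_injective _ hinj, Finset.card_univ, Fintype.card_fin]
    · simp only [y₀]; split_ifs <;> simp
    · simp only [z₀]; split_ifs <;> simp
  have hLP : LPFeasible k y₀ z₀ :=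
    ⟨hIP.assign, hIP.le_open, hIP.count,
      fun p => by rcases hIP.y_binary p with h | h <;> simp [h],
      fun p q => by rcases hIP.z_binary p q with h | h <;> simp [h]⟩
  have hcost : cost d z₀ = ∑ q, a q - k * w := by
    have h1 : cost d z₀ = ∑ q, d (s (label q)) q := by
      rw [cost, Finset.sum_comm]
      simp [z₀]
    have h2 : (k : ℝ) * w = ∑ q, (a q - d (s (label q)) q) := by
      have h3 : (k : ℝ) * w = ∑ i : Fin k, ∑ q, max (a q - d (s i) q) 0 := by
        simp [hcenter]
      rw [h3, Finset.sum_comm]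
      refine Finset.sum_congr rfl fun q _ => ?_
      rw [Finset.sum_eq_single (label q)]
      · exact max_eq_left (sub_nonneg.2 (hown q))
      · intro i _ hi
        exact max_eq_right (by linarith [hother i q hi])
      · simp
    rw [h1, h2, Finset.sum_sub_distrib]; ring
  refine ⟨y₀, z₀, ⟨hLP, fun y' z' h => hcost ▸ hlow y' z' h⟩, ?_, hIP, ?_⟩
  · rintro y z ⟨h, hopt⟩
    -- Complementary slackness: every summand of the slack vanishes.
    have hz : cost d z - (∑ q, a q - k * w) = 0 := by
      have := hopt y₀ z₀ hLP
      have := hlow y z h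
      linarith
    rw [hslack y z h, Finset.sum_eq_zero_iff_of_nonneg fun p _ =>
      add_nonneg (Finset.sum_nonneg fun q _ => hterm1 y z h p q) (hterm2 y z h p)] at hz
    have hy : ∀ p, (∀ i, s i ≠ p) → y p = 0 := by
      intro p hp
      have h1 := hz p (Finset.mem_univ p)
      have h2 := ((add_eq_zero_iff_of_nonneg (Finset.sum_nonneg fun q _ => hterm1 y z h p q)
        (hterm2 y z h p)).1 h1).2
      rcases mul_eq_zero.1 h2 with h3 | h3
      · exact h3
      · linarith [hnoncenter p hp]
    have hzero : ∀ p q, s (label q) ≠ p → z p q = 0 := by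
      intro p q hp
      by_cases hc : ∃ i, s i = p
      · obtain ⟨i, rfl⟩ := hc
        have h1 := hz (s i) (Finset.mem_univ _)
        have h2 := ((add_eq_zero_iff_of_nonneg
          (Finset.sum_nonneg fun q _ => hterm1 y z h (s i) q) (hterm2 y z h (s i))).1 h1).1
        rw [Finset.sum_eq_zero_iff_of_nonneg fun q _ => hterm1 y z h (s i) q] at h2
        have h3 := hother i q (fun hi => hp (by rw [hi]))
        have h4 := h2 q (Finset.mem_univ q)
        rw [max_eq_left (by linarith), max_eq_right (by linarith), zero_mul, add_zero] at h4
        rcases mul_eq_zero.1 h4 with h5 | h5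
        · linarith
        · exact h5
      · exact le_antisymm ((h.le_open p q).trans (hy p fun i hi => hc ⟨i, hi⟩).le)
          (h.z_nonneg p q)
    have hone : ∀ q, z (s (label q)) q = 1 := by
      intro q
      rw [← h.assign q]
      exact (Finset.sum_eq_single _ (fun p _ hp => hzero p q hp.symm) (by simp)).symm
    have hzz : z = z₀ := by
      funext p q
      simp only [z₀]
      split_ifs with hp
      · rw [← hp, hone]
      · exact hzero p q hp
    refine ⟨?_, hzz⟩
    have hge : ∀ p ∈ Finset.univ, y₀ p ≤ y p := by
      intro p _
      simp only [y₀]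
      split_ifs with hp
      · obtain ⟨i, rfl⟩ := hp
        have h1 := hone (s i)
        rw [hs] at h1
        exact h1 ▸ h.le_open (s i) (s i)
      · exact h.y_nonneg p
    have := (Finset.sum_eq_sum_iff_of_le hge).1 (by rw [hLP.count, h.count])
    funext p
    exact (this p (Finset.mem_univ p)).symm
  · intro p q hpq
    by_cases hp : s (label q) = p
    · rw [← hp, hs]
    · simp [z₀, hp] at hpq

/-! ### Uniqueness of the sample median -/

section Geometry

variable {E : Type*} [NormedAddCommGroup E] [InnerProductSpace ℝ E]

/-- Off the two rays that prolong the segment from `p` to `p'`, the difference of the distances to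
`p` and to `p'` is strictly monotone in the direction `p' - p`: this is strict convexity of the
norm. On the two rays the difference is `± dist p p'`. -/
theorem abs_dist_sub_dist_eq_of_translate {p p' y : E} {s : ℝ} (hs : 0 < s)
    (h : dist p (y + s • (p' - p)) - dist p' (y + s • (p' - p)) = dist p y - dist p' y) :
    |dist p y - dist p' y| = dist p p' := by
  -- With `v = p' - p`, the vectors `y - p` and `y + s • v - p'` are the convex combinations of
  -- `b = y - p'` and `c = y + s • v - p` with weights `s : 1` and `1 : s`. The hypothesis says that
  -- the sum of the two triangle inequalities is an equality, so `b` and `c` are on one ray.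
  set b : E := y - p' with hb
  set c : E := y + s • (p' - p) - p with hc
  have ha' : (1 + s) • (y - p) = s • b + c := by rw [hb, hc]; module
  have he' : (1 + s) • (y + s • (p' - p) - p') = b + s • c := by rw [hb, hc]; module
  have hv' : (1 + s) • (p' - p) = c - b := by rw [hb, hc]; module
  have hs1 : (0 : ℝ) < 1 + s := by linarith
  have na : (1 + s) * dist p y = ‖s • b + c‖ := by
    rw [← ha', norm_smul, Real.norm_of_nonneg hs1.le, dist_comm, dist_eq_norm]
  have ne : (1 + s) * dist p' (y + s • (p' - p)) = ‖b + s • c‖ := by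
    rw [← he', norm_smul, Real.norm_of_nonneg hs1.le, dist_comm, dist_eq_norm]
  have nv : (1 + s) * dist p p' = ‖c - b‖ := by
    rw [← hv', norm_smul, Real.norm_of_nonneg hs1.le, dist_comm, dist_eq_norm]
  have nb : dist p' y = ‖b‖ := by rw [dist_comm, dist_eq_norm]
  have nc : dist p (y + s • (p' - p)) = ‖c‖ := by rw [dist_comm, dist_eq_norm]
  have nsb : ‖s • b‖ = s * ‖b‖ := by rw [norm_smul, Real.norm_of_nonneg hs.le]
  have nsc : ‖s • c‖ = s * ‖c‖ := by rw [norm_smul, Real.norm_of_nonneg hs.le]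
  have t1 := norm_add_le (s • b) c
  have t2 := norm_add_le b (s • c)
  rw [nb, nc] at h
  have h' := congrArg (fun t => (1 + s) * t) h
  simp only [mul_sub, na, ne] at h'
  have heq : ‖s • b + c‖ = ‖s • b‖ + ‖c‖ := by
    rw [nsb] at t1 ⊢
    rw [nsc] at t2
    nlinarith
  obtain ⟨u, v, hu, hv, huv, hsu, hcv⟩ := (sameRay_iff_norm_add.2 heq).exists_eq_smul_add
  set W := s • b + c with hW
  have hbW : b = (s⁻¹ * u) • W := by
    rw [mul_smul, ← hsu, smul_smul, inv_mul_cancel₀ hs.ne', one_smul]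
  have nbW : ‖b‖ = s⁻¹ * u * ‖W‖ := by
    conv_lhs => rw [hbW]
    rw [norm_smul, Real.norm_of_nonneg (by positivity)]
  have nvW : ‖c - b‖ = |v - s⁻¹ * u| * ‖W‖ := by
    conv_lhs => rw [hbW, hcv]
    rw [← sub_smul, norm_smul, Real.norm_eq_abs]
  apply mul_left_cancel₀ hs1.ne'
  rw [nv, nvW, nb]
  calc (1 + s) * |dist p y - ‖b‖| = |(1 + s) * (dist p y - ‖b‖)| := by
        rw [abs_mul, abs_of_pos hs1]
    _ = |(v - s⁻¹ * u) * ‖W‖| := by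
        rw [mul_sub, na, nbW, show v = 1 - u by linarith]
        congr 1
        field_simp
        ring
    _ = |v - s⁻¹ * u| * ‖W‖ := by rw [abs_mul, abs_of_nonneg (norm_nonneg W)]

variable [FiniteDimensional ℝ E] [MeasurableSpace E] [BorelSpace E]

theorem addHaar_dist_sub_dist_level_eq_zero (ν : Measure E) [ν.IsAddHaarMeasure] {p p' : E} {t : ℝ}
    (ht : |t| < dist p p') : ν {y | dist p y - dist p' y = t} = 0 := by
  have hpp : p' - p ≠ 0 := fun h => by
    rw [sub_eq_zero.1 h, dist_self] at ht
    exact absurd ht (abs_nonneg t).not_gt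
  -- The translates of the level set by distinct multiples of `p' - p` are pairwise disjoint.
  refine Measure.addHaar_eq_zero_of_disjoint_translates ν
    (fun n : ℕ => ((1 : ℝ) / (n + 1)) • (p' - p)) ?_ ?_ ?_
  · refine (Metric.isBounded_closedBall (x := (0 : E)) (r := ‖p' - p‖)).subset ?_
    rintro _ ⟨n, rfl⟩
    rw [mem_closedBall_zero_iff, norm_smul, Real.norm_of_nonneg (by positivity)]
    refine mul_le_of_le_one_left (norm_nonneg _) ?_
    rw [div_le_one (by positivity)]
    linarith [(Nat.cast_nonneg n : (0 : ℝ) ≤ n)]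
  · have key : ∀ (i j : ℝ) (x : E), j < i →
        dist p (x - i • (p' - p)) - dist p' (x - i • (p' - p)) = t →
        dist p (x - j • (p' - p)) - dist p' (x - j • (p' - p)) = t → False := by
      intro i j x hij hi hj
      have h := abs_dist_sub_dist_eq_of_translate (p := p) (p' := p') (y := x - i • (p' - p))
        (sub_pos.2 hij) (by
          rw [show x - i • (p' - p) + (i - j) • (p' - p) = x - j • (p' - p) by module, hi, hj])
      rw [hi] at h
      exact ht.ne h
    intro i j hij
    have hij' : (1 : ℝ) / (i + 1) ≠ 1 / (j + 1) := fun h => hij (by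
      have hi : (i : ℝ) + 1 ≠ 0 := by positivity
      have hj : (j : ℝ) + 1 ≠ 0 := by positivity
      field_simp at h
      exact_mod_cast (add_right_cancel h).symm)
    rw [Function.onFun, Set.disjoint_left]
    intro x hxi hxj
    simp only [Set.singleton_add, Set.image_add_left, Set.mem_preimage, Set.mem_ofPred_eq,
      neg_add_eq_sub] at hxi hxj
    rcases lt_or_gt_of_ne hij' with h | h
    · exact key _ _ x h hxj hxi
    · exact key _ _ x h hxi hxj
  · exact (isClosed_eq (by fun_prop) continuous_const).measurableSet

/-- Equality in the triangle inequality puts the point on the line through `p` and `p'`. -/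
theorem addHaar_abs_dist_sub_dist_eq_dist_eq_zero (ν : Measure E) [ν.IsAddHaarMeasure]
    (hE : 2 ≤ Module.finrank ℝ E) {p p' : E} (hpp : p ≠ p') :
    ν {y | |dist p y - dist p' y| = dist p p'} = 0 := by
  have htop : affineSpan ℝ ({p, p'} : Set E) ≠ ⊤ := by
    intro h
    have h1 := (collinear_iff_finrank_le_one (k := ℝ)).1 (collinear_pair ℝ p p')
    rw [← direction_affineSpan, h, AffineSubspace.direction_top, finrank_top] at h1
    omega
  refine measure_mono_null (fun y hy => ?_) (Measure.addHaar_affineSubspace ν _ htop)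
  have hcol : Collinear ℝ ({p, p', y} : Set E) := by
    rcases abs_cases (dist p y - dist p' y) with h | h
    · have : Wbtw ℝ p p' y := dist_add_dist_eq_iff.1 (by
        have := hy.symm; linarith [h.1])
      exact this.collinear
    · have : Wbtw ℝ p' p y := dist_add_dist_eq_iff.1 (by
        have := hy.symm; rw [dist_comm p' p]; linarith [h.1])
      exact Set.insert_comm p p' _ ▸ this.collinear
  exact hcol.mem_affineSpan_of_mem_of_ne (by simp) (by simp) (by simp) hpp

end Geometry

/-- A measurable set in a finite product is null if all its sections in direction of one coordinate
are null. -/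
theorem measure_pi_null_of_update {ι : Type*} [Fintype ι] [DecidableEq ι] {X : ι → Type*}
    [∀ i, MeasurableSpace (X i)] (ν : ∀ i, Measure (X i)) [∀ i, SigmaFinite (ν i)]
    {S : Set (∀ i, X i)} (hS : MeasurableSet S) (i : ι)
    (h : ∀ x, ν i {y | Function.update x i y ∈ S} = 0) : Measure.pi ν S = 0 := by
  rcases isEmpty_or_nonempty (∀ i, X i) with hX | ⟨⟨x⟩⟩
  · rw [Set.eq_empty_of_isEmpty S, measure_empty]
  rw [← lintegral_indicator_one hS, lintegral_eq_lmarginal_univ x,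
    lmarginal_erase' _ (measurable_one.indicator hS) (Finset.mem_univ i)]
  have : (fun x => ∫⁻ y, S.indicator (1 : (∀ i, X i) → ENNReal) (Function.update x i y) ∂(ν i)) =
      fun _ => 0 := by
    funext x
    have h1 : (fun y => S.indicator (1 : (∀ i, X i) → ENNReal) (Function.update x i y)) =
        (Function.update x i ⁻¹' S).indicator 1 := by
      funext y; rfl
    rw [h1, lintegral_indicator_one (measurable_update x hS)]
    exact h x
  rw [this]
  simp [lmarginal]

theorem even_card_of_sum_eq_zero_of_abs_eq {ι : Type*} (S : Finset ι) (t : ι → ℝ) {D : ℝ}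
    (hD : D ≠ 0) (ht : ∀ q ∈ S, |t q| = D) (hsum : ∑ q ∈ S, t q = 0) : Even S.card := by
  have h1 : ∀ q, ∃ e : ℤ, q ∈ S → t q = (2 * e + 1 : ℤ) * D := by
    intro q
    by_cases hq : q ∈ S
    · rcases abs_choice (t q) with h | h
      · exact ⟨0, fun _ => by rw [← ht q hq, h]; simp⟩
      · exact ⟨-1, fun _ => by rw [← ht q hq, h]; simp⟩
    · exact ⟨0, fun h => absurd h hq⟩
  choose e he using h1
  have h2 : ((∑ q ∈ S, (2 * e q + 1) : ℤ) : ℝ) * D = 0 := by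
    rw [← hsum, Int.cast_sum, Finset.sum_mul]
    exact Finset.sum_congr rfl fun q hq => (he q hq).symm
  have h3 : ∑ q ∈ S, (2 * e q + 1) = 0 := by exact_mod_cast (mul_eq_zero.1 h2).resolve_right hD
  rw [Finset.sum_add_distrib, ← Finset.mul_sum, Finset.sum_const, nsmul_eq_mul, mul_one] at h3
  rw [← Int.even_coe_nat]
  exact ⟨-∑ q ∈ S, e q, by linarith⟩

/-- Almost surely, distinct points of a random sample have distinct sums of distances to the sample,
so that the sample median is unique. A tie between `p` and `p'` is a condition on any third point
`q` that forces it into a level set of `dist p · - dist p' ·`, which is null unless its level is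
`± dist p p'`. The extreme levels are null as well in dimension at least two; in dimension one, if
all the differences are extreme, then they cannot add up to zero for an odd number of points. -/
theorem ae_injOn_sum_dist {E : Type*} [NormedAddCommGroup E] [InnerProductSpace ℝ E]
    [FiniteDimensional ℝ E] [MeasurableSpace E] [BorelSpace E] {ι : Type*} [Fintype ι]
    (vol : Measure E) [vol.IsAddHaarMeasure] (ν : ι → Measure E) [∀ i, SigmaFinite (ν i)]
    (hac : ∀ i, ν i ≪ vol) (S : Finset ι)
    (hS : 1 ≤ Module.finrank ℝ E ∧ Odd S.card ∨ 2 ≤ Module.finrank ℝ E ∧ 3 ≤ S.card) :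
    ∀ᵐ x ∂Measure.pi ν, Set.InjOn (fun p => ∑ q ∈ S, dist (x p) (x q)) S := by
  classical
  have hE : 1 ≤ Module.finrank ℝ E := by omega
  have : Nontrivial E := Module.nontrivial_of_finrank_pos (R := ℝ) (by omega)
  have hdistinct : ∀ᵐ x ∂Measure.pi ν, ∀ p p' : ι, p ≠ p' → x p ≠ x p' := by
    refine ae_all_iff.2 fun p => ae_all_iff.2 fun p' => ?_
    by_cases hp : p = p'
    · exact Filter.Eventually.of_forall fun _ h => absurd hp h
    simp only [ne_eq, hp, not_false_eq_true, true_implies]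
    rw [ae_iff]
    simp only [not_not]
    refine measure_pi_null_of_update ν
      (isClosed_eq (by fun_prop) (by fun_prop)).measurableSet p fun x => hac p ?_
    simp only [Set.mem_ofPred_eq, Function.update_self, Function.update_of_ne (Ne.symm hp)]
    exact measure_singleton (x p')
  have hlevel : ∀ᵐ x ∂Measure.pi ν, ∀ p p' q : ι, p ∈ S → p' ∈ S → q ∈ S → q ≠ p → q ≠ p' →
      ¬ (∑ r ∈ S, (dist (x p) (x r) - dist (x p') (x r)) = 0 ∧
        |dist (x p) (x q) - dist (x p') (x q)| < dist (x p) (x p')) := by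
    refine ae_all_iff.2 fun p => ae_all_iff.2 fun p' => ae_all_iff.2 fun q => ?_
    by_cases hall : p ∈ S ∧ p' ∈ S ∧ q ∈ S ∧ q ≠ p ∧ q ≠ p'
    swap
    · exact Filter.Eventually.of_forall fun _ h1 h2 h3 h4 h5 => absurd ⟨h1, h2, h3, h4, h5⟩ hall
    obtain ⟨h1, h2, h3, h4, h5⟩ := hall
    simp only [h1, h2, h3, h4, h5, ne_eq, not_false_eq_true, true_implies]
    rw [ae_iff]
    simp only [not_not]
    refine measure_pi_null_of_update ν ?_ q fun x => hac q ?_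
    · have hc : IsClosed {x : ι → E | ∑ r ∈ S, (dist (x p) (x r) - dist (x p') (x r)) = 0} :=
        isClosed_eq (by fun_prop) continuous_const
      have ho : IsOpen {x : ι → E |
          |dist (x p) (x q) - dist (x p') (x q)| < dist (x p) (x p')} :=
        isOpen_lt (by fun_prop) (by fun_prop)
      exact hc.measurableSet.inter ho.measurableSet
    · simp only [Set.mem_ofPred_eq, Function.update_self, Function.update_of_ne (Ne.symm h4),
        Function.update_of_ne (Ne.symm h5)]
      set C := ∑ r ∈ S.erase q, (dist (x p) (x r) - dist (x p') (x r)) with hC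
      have hsum : ∀ y, ∑ r ∈ S, (dist (x p) (Function.update x q y r)
          - dist (x p') (Function.update x q y r)) = dist (x p) y - dist (x p') y + C := by
        intro y
        rw [← Finset.add_sum_erase S _ h3, Function.update_self, hC]
        congr 1
        exact Finset.sum_congr rfl fun r hr => by
          rw [Function.update_of_ne (Finset.ne_of_mem_erase hr)]
      simp only [hsum]
      by_cases hlt : |(-C)| < dist (x p) (x p')
      · refine measure_mono_null (fun y hy => ?_)
          (addHaar_dist_sub_dist_level_eq_zero vol hlt)
        exact eq_neg_of_add_eq_zero_left hy.1
      · refine measure_mono_null (t := ∅) (fun y hy => hlt ?_) measure_empty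
        rw [← eq_neg_of_add_eq_zero_left hy.1]
        exact hy.2
  have hline : 2 ≤ Module.finrank ℝ E → ∀ᵐ x ∂Measure.pi ν, ∀ p p' q : ι, q ≠ p → q ≠ p' →
      x p ≠ x p' → |dist (x p) (x q) - dist (x p') (x q)| ≠ dist (x p) (x p') := by
    intro hE2
    refine ae_all_iff.2 fun p => ae_all_iff.2 fun p' => ae_all_iff.2 fun q => ?_
    by_cases hall : q ≠ p ∧ q ≠ p'
    swap
    · exact Filter.Eventually.of_forall fun _ h4 h5 => absurd ⟨h4, h5⟩ hall
    obtain ⟨h4, h5⟩ := hall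
    have : ∀ᵐ x ∂Measure.pi ν, ¬ (x p ≠ x p' ∧
        |dist (x p) (x q) - dist (x p') (x q)| = dist (x p) (x p')) := by
      rw [ae_iff]
      simp only [not_not]
      refine measure_pi_null_of_update ν ?_ q fun x => hac q ?_
      · exact (isOpen_ne_fun (by fun_prop) (by fun_prop)).measurableSet.inter
          (isClosed_eq (by fun_prop) (by fun_prop)).measurableSet
      · simp only [Set.mem_ofPred_eq, Function.update_self, Function.update_of_ne (Ne.symm h4),
          Function.update_of_ne (Ne.symm h5)]
        by_cases hpp : x p = x p'
        · simp [hpp]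
        · exact measure_mono_null (fun y hy => hy.2)
            (addHaar_abs_dist_sub_dist_eq_dist_eq_zero vol hE2 hpp)
    filter_upwards [this] with x hx _ _ hne heq
    exact hx ⟨hne, heq⟩
  have hline' : ∀ᵐ x ∂Measure.pi ν, 2 ≤ Module.finrank ℝ E → ∀ p p' q : ι, q ≠ p → q ≠ p' →
      x p ≠ x p' → |dist (x p) (x q) - dist (x p') (x q)| ≠ dist (x p) (x p') := by
    by_cases hE2 : 2 ≤ Module.finrank ℝ E
    · filter_upwards [hline hE2] with x hx _ using hx
    · exact Filter.Eventually.of_forall fun _ h => absurd h hE2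
  filter_upwards [hdistinct, hlevel, hline'] with x hx1 hx2 hx3
  intro p hp p' hp' heq
  by_contra hne
  have hxne := hx1 p p' hne
  have hsum : ∑ r ∈ S, (dist (x p) (x r) - dist (x p') (x r)) = 0 := by
    rw [Finset.sum_sub_distrib]
    exact sub_eq_zero.2 heq
  have htri : ∀ q, |dist (x p) (x q) - dist (x p') (x q)| ≤ dist (x p) (x p') := fun q =>
    abs_dist_sub_le _ _ _
  have habs : ∀ q ∈ S, |dist (x p) (x q) - dist (x p') (x q)| = dist (x p) (x p') := by
    intro q hq
    by_cases h4 : q = p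
    · subst h4; simp [dist_comm]
    by_cases h5 : q = p'
    · subst h5; simp
    exact (htri q).antisymm (not_lt.1 fun hlt => hx2 p p' q hp hp' hq h4 h5 ⟨hsum, hlt⟩)
  rcases hS with ⟨-, hodd⟩ | ⟨hE2, hcard⟩
  · exact Nat.not_even_iff_odd.2 hodd
      (even_card_of_sum_eq_zero_of_abs_eq S _ (dist_ne_zero.2 hxne) habs hsum)
  · obtain ⟨q, hq⟩ : ((S.erase p).erase p').Nonempty := by
      rw [← Finset.card_pos]
      have h1 := Finset.pred_card_le_card_erase (s := S) (a := p)
      have h2 := Finset.pred_card_le_card_erase (s := S.erase p) (a := p')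
      omega
    rw [Finset.mem_erase, Finset.mem_erase] at hq
    exact hx3 hE2 p p' q hq.2.1 hq.1 hxne (habs q hq.2.2)

/-! ### Laws of large numbers for the contribution function -/

namespace ESBM

variable {k m : ℕ} (M : ESBM k m)

instance (i : Fin k) : IsProbabilityMeasure (M.μ i) := M.isProbabilityMeasure i

instance (N : Fin k → ℕ) : IsProbabilityMeasure (M.sampleLaw N) := by
  unfold sampleLaw; infer_instance

theorem contribution_eq_sum {N : Fin k → ℕ} (α : Fin k → ℝ)
    (x : (Σ i : Fin k, Fin (N i)) → EuclideanSpace ℝ (Fin m)) (z : EuclideanSpace ℝ (Fin m)) :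
    contribution α x z = ∑ q, max (α q.1 - dist z (x q)) 0 := by
  rw [contribution, Fintype.sum_sigma]

theorem max_sub_dist_mem_Icc (a : ℝ) (z x : EuclideanSpace ℝ (Fin m)) :
    max (a - dist z x) 0 ∈ Set.Icc 0 |a| :=
  ⟨le_max_right _ _, max_le (by linarith [le_abs_self a, dist_nonneg (x := z) (y := x)])
    (abs_nonneg a)⟩

theorem integrable_max_sub_dist (i : Fin k) (a : ℝ) (z : EuclideanSpace ℝ (Fin m)) :
    Integrable (fun x => max (a - dist z x) 0) (M.μ i) := by
  refine Integrable.of_bound (C := |a|)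
    (by fun_prop : Continuous fun x => max (a - dist z x) 0).aestronglyMeasurable
    (Eventually.of_forall fun x => ?_)
  rw [Real.norm_of_nonneg (le_max_right _ _)]
  exact (max_sub_dist_mem_Icc a z x).2

theorem continuous_G (α : Fin k → ℝ) : Continuous (M.G α) := by
  unfold G
  refine continuous_finsetSum _ fun i _ => continuous_const.mul ?_
  refine continuous_of_dominated (bound := fun _ => |α i|)
    (fun z => (M.integrable_max_sub_dist i (α i) z).aestronglyMeasurable)
    (fun z => Eventually.of_forall fun x => ?_) (integrable_const _)
    (Eventually.of_forall fun x => by fun_prop)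
  rw [Real.norm_of_nonneg (le_max_right _ _)]
  exact (max_sub_dist_mem_Icc _ z x).2

theorem ae_mem_ball (i : Fin k) : ∀ᵐ x ∂M.μ i, x ∈ Metric.closedBall (M.c i) (M.r i) :=
  M.μ_compl_ball i

theorem ae_sampleLaw_mem_ball (N : Fin k → ℕ) :
    ∀ᵐ x ∂M.sampleLaw N, ∀ q, x q ∈ Metric.closedBall (M.c q.1) (M.r q.1) := by
  refine ae_all_iff.2 fun q => ?_
  exact (measurePreserving_eval (fun p : (Σ i : Fin k, Fin (N i)) => M.μ p.1)
    q).quasiMeasurePreserving.ae (M.ae_mem_ball q.1)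

/-- At the center of the `i`-th ball only the `i`-th measure contributes to `G α`, and on the `i`-th
ball the positive part can be dropped. -/
theorem G_center (α : Fin k → ℝ) (i : Fin k) (hr : M.r i ≤ α i)
    (hD : ∀ j, j ≠ i → α j ≤ dist (M.c j) (M.c i) - M.r j) :
    M.G α (M.c i) = M.β i * (α i - M.E i) := by
  rw [G, Finset.sum_eq_single i]
  · have h1 : ∫ x, max (α i - dist (M.c i) x) 0 ∂M.μ i = ∫ x, (α i - dist x (M.c i)) ∂M.μ i := by
      refine integral_congr_ae ?_
      filter_upwards [M.ae_mem_ball i] with x hx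
      rw [Metric.mem_closedBall] at hx
      rw [max_eq_left (by rw [dist_comm]; linarith), dist_comm]
    have h2 : Integrable (fun x => dist x (M.c i)) (M.μ i) := by
      refine Integrable.of_bound (C := M.r i)
        (by fun_prop : Continuous fun x => dist x (M.c i)).aestronglyMeasurable ?_
      filter_upwards [M.ae_mem_ball i] with x hx
      rw [Real.norm_of_nonneg dist_nonneg]
      exact hx
    rw [h1, integral_sub (integrable_const _) h2, E]
    simp
  · intro j _ hj
    have h1 : ∫ x, max (α j - dist (M.c i) x) 0 ∂M.μ j = ∫ x, (0 : ℝ) ∂M.μ j := by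
      refine integral_congr_ae ?_
      filter_upwards [M.ae_mem_ball j] with x hx
      rw [Metric.mem_closedBall] at hx
      have h2 := dist_triangle (M.c j) x (M.c i)
      rw [dist_comm (M.c j) x, dist_comm x (M.c i)] at h2
      exact max_eq_right (by linarith [hD j hj])
    rw [h1]; simp
  · simp

theorem sum_card_eq {n : ℕ} {N : Fin k → ℕ} (hN : ∀ i, (N i : ℝ) = M.β i * n) (f : Fin k → ℝ) :
    ∑ q : (Σ i : Fin k, Fin (N i)), f q.1 = (∑ i, M.β i * f i) * n := by
  rw [Fintype.sum_sigma, Finset.sum_mul]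
  refine Finset.sum_congr rfl fun i _ => ?_
  simp only [Finset.sum_const, Finset.card_univ, Fintype.card_fin, nsmul_eq_mul, hN]
  ring

/-- The property `A n N x` of the sample `x` with sample sizes `N i = β i * n` holds with
probability tending to `1` as `n` tends to infinity. The exceptional sets need not be
measurable; their outer measure is required to tend to `0`. -/
def WithHighProbability
    (A : ℕ → ∀ N : Fin k → ℕ, ((Σ i : Fin k, Fin (N i)) → EuclideanSpace ℝ (Fin m)) → Prop) :
    Prop :=
  ∀ η : ℝ, 0 < η → ∀ᶠ n : ℕ in atTop, ∀ N : Fin k → ℕ, (∀ i, (N i : ℝ) = M.β i * n) →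
    M.sampleLaw N {x | ¬ A n N x} ≤ ENNReal.ofReal η

namespace WithHighProbability

variable {M}
  {A A' : ℕ → ∀ N : Fin k → ℕ, ((Σ i : Fin k, Fin (N i)) → EuclideanSpace ℝ (Fin m)) → Prop}

theorem mono (h : M.WithHighProbability A)
    (hA : ∀ᶠ n : ℕ in atTop, ∀ N : Fin k → ℕ, (∀ i, (N i : ℝ) = M.β i * n) →
      ∀ x, A n N x → A' n N x) : M.WithHighProbability A' := by
  intro η hη
  filter_upwards [h η hη, hA] with n h1 h2 N hN
  exact (measure_mono fun x (hx : ¬ A' n N x) hx' => hx (h2 N hN x hx')).trans (h1 N hN)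

theorem and (h : M.WithHighProbability A) (h' : M.WithHighProbability A') :
    M.WithHighProbability fun n N x => A n N x ∧ A' n N x := by
  intro η hη
  filter_upwards [h (η / 2) (by linarith), h' (η / 2) (by linarith)] with n h1 h2 N hN
  calc M.sampleLaw N {x | ¬ (A n N x ∧ A' n N x)}
      ≤ M.sampleLaw N ({x | ¬ A n N x} ∪ {x | ¬ A' n N x}) :=
        measure_mono fun x hx => not_and_or.1 hx
    _ ≤ ENNReal.ofReal (η / 2) + ENNReal.ofReal (η / 2) :=
        (measure_union_le _ _).trans (add_le_add (h1 N hN) (h2 N hN))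
    _ = ENNReal.ofReal η := by
        rw [← ENNReal.ofReal_add (by linarith) (by linarith), add_halves]

theorem forall_finset {κ : Type*} (F : Finset κ)
    {B : κ → ℕ → ∀ N : Fin k → ℕ, ((Σ i : Fin k, Fin (N i)) → EuclideanSpace ℝ (Fin m)) → Prop}
    (h : ∀ f ∈ F, M.WithHighProbability (B f)) :
    M.WithHighProbability fun n N x => ∀ f ∈ F, B f n N x := by
  classical
  induction F using Finset.induction_on with
  | empty =>
    intro η _
    simp
  | insert a F _ ih =>
    refine ((h a (Finset.mem_insert_self a F)).and
      (ih fun f hf => h f (Finset.mem_insert_of_mem hf))).mono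
      (Eventually.of_forall fun n N _ x hx f hf => ?_)
    rcases Finset.mem_insert.1 hf with rfl | hf
    · exact hx.1
    · exact hx.2 f hf

theorem of_ae (h : ∀ N, ∀ᵐ x ∂M.sampleLaw N, ∀ n, A n N x) : M.WithHighProbability A := by
  intro η _
  refine Eventually.of_forall fun n N _ => ?_
  have : M.sampleLaw N {x | ¬ A n N x} = 0 := by
    rw [← ae_iff]
    filter_upwards [h N] with x hx using hx n
  rw [this]
  exact zero_le

end WithHighProbability

/-- The weak law of large numbers for the contribution function at a fixed point, by Chebyshev's
inequality. -/
theorem withHighProbability_contribution (α : Fin k → ℝ) (z : EuclideanSpace ℝ (Fin m))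
    {ε : ℝ} (hε : 0 < ε) :
    M.WithHighProbability fun n N x => |contribution (N := N) α x z - n * M.G α z| < ε * n := by
  intro η hη
  set V : ℝ := ∑ i, M.β i * (|α i| / 2) ^ 2 with hV
  have hlim : Tendsto (fun n : ℕ => V / ε ^ 2 / (n : ℝ)) atTop (nhds 0) :=
    tendsto_const_div_atTop_nhds_zero_nat _
  filter_upwards [hlim.eventually (gt_mem_nhds hη), eventually_gt_atTop 0] with n hn hn0 N hN
  have hn0' : (0 : ℝ) < n := by exact_mod_cast hn0
  have hmem : ∀ q : (Σ i : Fin k, Fin (N i)),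
      MemLp (fun y => max (α q.1 - dist z y) 0) 2 (M.μ q.1) := fun q =>
    MemLp.of_bound (M.integrable_max_sub_dist q.1 (α q.1) z).aestronglyMeasurable |α q.1|
      (Eventually.of_forall fun y => by
        rw [Real.norm_of_nonneg (le_max_right _ _)]
        exact (max_sub_dist_mem_Icc _ z y).2)
  have hC : (fun x => contribution (N := N) α x z) =
      ∑ q, fun x : (Σ i : Fin k, Fin (N i)) → EuclideanSpace ℝ (Fin m) =>
        max (α q.1 - dist z (x q)) 0 := by
    funext x
    rw [contribution_eq_sum, Finset.sum_apply]
  have hvar : variance (fun x => contribution (N := N) α x z) (M.sampleLaw N) ≤ V * n := by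
    rw [hC, sampleLaw, variance_sum_pi (μ := fun p : (Σ i : Fin k, Fin (N i)) => M.μ p.1)
      (X := fun q y => max (α q.1 - dist z y) 0) hmem, hV, ← M.sum_card_eq hN]
    refine Finset.sum_le_sum fun q _ => ?_
    have := variance_le_sq_of_bounded (μ := M.μ q.1)
      (Eventually.of_forall fun y => max_sub_dist_mem_Icc (α q.1) z y)
      (hmem q).aestronglyMeasurable.aemeasurable
    rwa [sub_zero] at this
  have hLp : MemLp (fun x => contribution (N := N) α x z) 2 (M.sampleLaw N) := by
    rw [hC]
    refine memLp_finsetSum' _ fun q _ => ?_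
    exact (hmem q).comp_measurePreserving
      (measurePreserving_eval (fun p : (Σ i : Fin k, Fin (N i)) => M.μ p.1) q)
  have hmean : ∫ x, contribution (N := N) α x z ∂M.sampleLaw N = n * M.G α z := by
    rw [M.G_eq_expected_contribution α z hn0 N hN]
    field_simp
  have hcheb := meas_ge_le_variance_div_sq hLp (mul_pos hε hn0')
  rw [hmean] at hcheb
  simp only [not_lt]
  refine hcheb.trans (ENNReal.ofReal_le_ofReal ?_)
  refine le_trans ?_ hn.le
  rw [div_le_iff₀ (by positivity)]
  refine hvar.trans (le_of_eq ?_)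
  field_simp

/-- The contribution function is Lipschitz in `z`, with the total sample size as constant. -/
theorem abs_contribution_sub_le {n : ℕ} {N : Fin k → ℕ} (hN : ∀ i, (N i : ℝ) = M.β i * n)
    (α : Fin k → ℝ) (x : (Σ i : Fin k, Fin (N i)) → EuclideanSpace ℝ (Fin m))
    (z z' : EuclideanSpace ℝ (Fin m)) :
    |contribution α x z - contribution α x z'| ≤ (∑ i, M.β i) * n * dist z z' := by
  have h := M.sum_card_eq hN (fun _ => dist z z')
  rw [← Finset.sum_mul, mul_right_comm] at h
  rw [contribution_eq_sum, contribution_eq_sum, ← Finset.sum_sub_distrib, ← h]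
  refine (Finset.abs_sum_le_sum_abs _ _).trans (Finset.sum_le_sum fun q _ => ?_)
  refine (abs_max_sub_max_le_abs _ _ _).trans ?_
  rw [sub_sub_sub_cancel_left, abs_sub_comm]
  exact abs_dist_sub_le _ _ _

/-- A one-sided uniform law of large numbers on a compact set, from the law at the points of a
finite net and the Lipschitz bound. -/
theorem withHighProbability_contribution_le (α : Fin k → ℝ)
    {K : Set (EuclideanSpace ℝ (Fin m))} (hK : IsCompact K) {b κ : ℝ} (hκ : 0 < κ)
    (hG : ∀ z ∈ K, M.G α z ≤ b - κ) :
    M.WithHighProbability fun n N x => ∀ z ∈ K, contribution (N := N) α x z ≤ (b - κ / 2) * n := by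
  have hB : 0 ≤ ∑ i, M.β i :=
    Finset.sum_nonneg fun i _ => zero_le_one.trans (M.one_le_β i)
  set B := ∑ i, M.β i with hBdef
  have he : 0 < κ / (4 * (B + 1)) := by positivity
  obtain ⟨t, htK, htfin, hcover⟩ := hK.finite_cover_balls he
  refine (WithHighProbability.forall_finset htfin.toFinset fun z _ =>
    M.withHighProbability_contribution α z (show 0 < κ / 4 by linarith)).mono
    (Eventually.of_forall fun n N hN x hx z hz => ?_)
  obtain ⟨z', hz', hzz'⟩ := Set.mem_iUnion₂.1 (hcover hz)
  have h1 := (abs_lt.1 (hx z' (htfin.mem_toFinset.2 hz'))).2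
  have h2 := (abs_le.1 (M.abs_contribution_sub_le hN α x z z')).2
  have h3 := hG z' (htK hz')
  have hn : (0 : ℝ) ≤ n := Nat.cast_nonneg n
  have h4 : B * n * dist z z' ≤ κ / 4 * n := by
    have h5 : B * dist z z' ≤ κ / 4 := by
      calc B * dist z z' ≤ (B + 1) * (κ / (4 * (B + 1))) :=
            mul_le_mul (by linarith) (Metric.mem_ball.1 hzz').le dist_nonneg (by linarith)
        _ = κ / 4 := by field_simp
    calc B * n * dist z z' = B * dist z z' * n := by ring
      _ ≤ _ := mul_le_mul_of_nonneg_right h5 hn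
  have h6 := mul_le_mul_of_nonneg_left h3 hn
  linarith

theorem withHighProbability_exists_near_center (i : Fin k) (hpos : M.PositiveNearCenter i)
    {ε : ℝ} (hε : 0 < ε) :
    M.WithHighProbability fun _ N x => ∃ l : Fin (N i), dist (x ⟨i, l⟩) (M.c i) < ε := by
  -- For this `α` the contribution at the center is positive only if a point of the `i`-th sample
  -- is `ε`-close to the center, and its expectation is positive by the assumption on `μ i`.
  set α : Fin k → ℝ := fun j => if j = i then ε else 0 with hα
  have hGpos : 0 < M.G α (M.c i) := by
    refine Finset.sum_pos' (fun j _ => mul_nonneg (zero_le_one.trans (M.one_le_β j))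
      (integral_nonneg fun x => le_max_right _ _)) ⟨i, Finset.mem_univ i, ?_⟩
    refine mul_pos (zero_lt_one.trans_le (M.one_le_β i)) ?_
    refine (integral_pos_iff_support_of_nonneg (fun x => le_max_right _ _)
      (M.integrable_max_sub_dist i (α i) (M.c i))).2 ?_
    refine (hpos _ Metric.isOpen_ball (Metric.mem_ball_self hε)).trans_le (measure_mono ?_)
    rintro x ⟨hx, -⟩
    have : 0 < α i - dist (M.c i) x := by
      simp only [hα, if_pos rfl]
      rw [dist_comm]
      exact sub_pos.2 hx
    exact (lt_max_of_lt_left this).ne'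
  refine (M.withHighProbability_contribution α (M.c i) hGpos).mono ?_
  filter_upwards with n N _ x hx
  by_contra! hcon
  have hzero : contribution α x (M.c i) = 0 := by
    refine Finset.sum_eq_zero fun j _ => Finset.sum_eq_zero fun l _ => max_eq_right ?_
    by_cases hj : j = i
    · subst hj
      simp only [hα, if_pos rfl]
      rw [dist_comm]
      linarith [hcon l]
    · simp only [hα, if_neg hj]
      linarith [dist_nonneg (x := M.c i) (y := x ⟨j, l⟩)]
  rw [hzero, zero_sub, abs_neg, mul_comm] at hx
  exact absurd (le_abs_self _) hx.not_ge

/-! ### From concentration to the dual certificate -/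

theorem card_filter_fst_eq (N : Fin k → ℕ) (i : Fin k) :
    (Finset.univ.filter fun q : (Σ i : Fin k, Fin (N i)) => q.1 = i).card = N i := by
  rw [Finset.card_filter, Fintype.sum_sigma, Finset.sum_eq_single i]
  · simp
  · intro j _ hj; simp [hj]
  · simp

/-- Close to the center of the `i`-th ball, the points of the other balls do not contribute, and for
the points of the `i`-th ball the positive part can be dropped. Hence the contribution function is
a constant minus the sum of the distances to the `i`-th sample. -/
theorem sum_max_sub_dist_of_near {N : Fin k → ℕ}
    {x : (Σ i : Fin k, Fin (N i)) → EuclideanSpace ℝ (Fin m)}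
    (hball : ∀ q, x q ∈ Metric.closedBall (M.c q.1) (M.r q.1)) {i : Fin k} {ρ : ℝ}
    {a : Fin k → ℝ} (hr : M.r i + ρ ≤ a i)
    (hD : ∀ j, j ≠ i → a j + ρ ≤ dist (M.c j) (M.c i) - M.r j)
    {z : EuclideanSpace ℝ (Fin m)} (hz : dist z (M.c i) ≤ ρ) :
    ∑ q, max (a q.1 - dist z (x q)) 0 =
      N i * a i - ∑ q with q.1 = i, dist z (x q) := by
  have h1 : (N i : ℝ) * a i = ∑ q : (Σ i : Fin k, Fin (N i)) with q.1 = i, a q.1 := by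
    rw [Finset.sum_congr rfl fun q hq => by rw [(Finset.mem_filter.1 hq).2], Finset.sum_const,
      card_filter_fst_eq, nsmul_eq_mul]
  rw [h1, ← Finset.sum_sub_distrib, Finset.sum_filter]
  refine Finset.sum_congr rfl fun q _ => ?_
  have hq := Metric.mem_closedBall.1 (hball q)
  split_ifs with hqi
  · refine max_eq_left ?_
    have h2 := dist_triangle_right z (x q) (M.c i)
    rw [hqi] at hq ⊢
    linarith
  · refine max_eq_right ?_
    have h2 := dist_triangle4 (M.c q.1) (x q) z (M.c i)
    rw [dist_comm (M.c q.1) (x q), dist_comm (x q) z] at h2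
    linarith [hD q.1 hqi]

/-- The deterministic part of the argument: a sample for which the contribution function is close to
its expectation at the centers, and not too large away from them, admits a dual certificate, with
dual variables `a i` close to `α i`. -/
theorem exactRecovery_of_concentration {n : ℕ} (hn : 0 < n) {N : Fin k → ℕ}
    (hN : ∀ i, (N i : ℝ) = M.β i * n) {α : Fin k → ℝ} {γ ρ ε κ : ℝ} (hρ : 0 < ρ)
    (hε : 0 < ε) (hερ : 2 * ε ≤ ρ) (hεκ : (∑ i, M.β i) * (2 * ε) < κ)
    (hr : ∀ i, M.r i + 4 * ρ ≤ α i)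
    (hD : ∀ i j, j ≠ i → α j + 4 * ρ ≤ dist (M.c j) (M.c i) - M.r j)
    {x : (Σ i : Fin k, Fin (N i)) → EuclideanSpace ℝ (Fin m)}
    (hball : ∀ q, x q ∈ Metric.closedBall (M.c q.1) (M.r q.1))
    (hnear : ∀ i, ∃ l : Fin (N i), dist (x ⟨i, l⟩) (M.c i) < ε)
    (hcenter : ∀ i, |contribution α x (M.c i) - n * γ| < ε * n)
    (hfar : ∀ i, ∀ z ∈ Metric.closedBall (M.c i) (M.r i), ρ ≤ dist z (M.c i) →
      contribution α x z ≤ (γ - κ) * n)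
    (hinj : ∀ i, Set.InjOn (fun p => ∑ q with q.1 = i, dist (x p) (x q))
      (Finset.univ.filter fun q : (Σ i : Fin k, Fin (N i)) => q.1 = i)) :
    ExactRecovery k (fun p q => dist (x p) (x q)) Sigma.fst := by
  have hn' : (0 : ℝ) < n := by exact_mod_cast hn
  have hNn : ∀ i, (n : ℝ) ≤ N i := fun i => by
    rw [hN]; exact le_mul_of_one_le_left hn'.le (M.one_le_β i)
  have hNpos : ∀ i, (0 : ℝ) < N i := fun i => hn'.trans_le (hNn i)
  set f : Fin k → EuclideanSpace ℝ (Fin m) → ℝ := fun i z => ∑ q with q.1 = i, dist z (x q)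
    with hf
  have hfsub : ∀ i z z', f i z ≤ f i z' + N i * dist z z' := by
    intro i z z'
    rw [← card_filter_fst_eq N i, ← nsmul_eq_mul, ← Finset.sum_const, hf,
      ← Finset.sum_add_distrib]
    refine Finset.sum_le_sum fun q _ => ?_
    linarith [dist_triangle z z' (x q)]
  have hfcenter : ∀ i, f i (M.c i) = N i * α i - contribution α x (M.c i) := by
    intro i
    rw [contribution_eq_sum, M.sum_max_sub_dist_of_near (ρ := ρ) hball (by linarith [hr i])
      (fun j hj => by linarith [hD i j hj]) (by rw [dist_self]; exact hρ.le)]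
    ring
  -- The center of a cluster is its best sample point among those close to the center of the ball.
  have hs : ∀ i, ∃ s : (Σ i : Fin k, Fin (N i)), s.1 = i ∧ dist (x s) (M.c i) < ρ ∧
      ∀ p : (Σ i : Fin k, Fin (N i)), p.1 = i → dist (x p) (M.c i) < ρ → f i (x s) ≤ f i (x p) := by
    intro i
    obtain ⟨l, hl⟩ := hnear i
    obtain ⟨s, hs, hmin⟩ := Finset.exists_min_image
      (Finset.univ.filter fun p : (Σ i : Fin k, Fin (N i)) => p.1 = i ∧ dist (x p) (M.c i) < ρ)
      (fun p => f i (x p)) ⟨⟨i, l⟩, by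
        rw [Finset.mem_filter]; exact ⟨Finset.mem_univ _, rfl, by linarith⟩⟩
    rw [Finset.mem_filter] at hs
    exact ⟨s, hs.2.1, hs.2.2, fun p h1 h2 => hmin p (by
      rw [Finset.mem_filter]; exact ⟨Finset.mem_univ _, h1, h2⟩)⟩
  choose s hs1 hs2 hsmin using hs
  -- The dual variables are chosen such that the contribution at every `x (s i)` is `n * γ`.
  set a : Fin k → ℝ := fun i => (n * γ + f i (x (s i))) / N i with ha
  have hNa : ∀ i, N i * a i = n * γ + f i (x (s i)) := fun i => by
    rw [ha]; field_simp [(hNpos i).ne']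
  -- Points away from the centers need the error in terms of `ε`, not of `ρ`, since `κ` depends on
  -- `ρ`. The point `x (s i)` is only `ρ`-close to the center, but it is at least as good as the
  -- sample point that is `ε`-close.
  have ha_le : ∀ i, a i ≤ α i + 2 * ε := by
    intro i
    obtain ⟨l, hl⟩ := hnear i
    have h1 := hsmin i ⟨i, l⟩ rfl (by linarith)
    have h2 := hfsub i (x ⟨i, l⟩) (M.c i)
    have h3 := (abs_lt.1 (hcenter i)).1
    have h4 := mul_le_mul_of_nonneg_left hl.le (hNpos i).le
    have h5 := mul_le_mul_of_nonneg_left (hNn i) hε.le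
    refine le_of_mul_le_mul_left ?_ (hNpos i)
    rw [hNa]
    linarith [hfcenter i]
  have hle_a : ∀ i, α i - 2 * ρ ≤ a i := by
    intro i
    have h2 := hfsub i (M.c i) (x (s i))
    rw [dist_comm] at h2
    have h3 := (abs_lt.1 (hcenter i)).2
    have h4 := mul_le_mul_of_nonneg_left (hs2 i).le (hNpos i).le
    have h5 := mul_le_mul (show ε ≤ ρ by linarith) (hNn i) hn'.le hρ.le
    refine le_of_mul_le_mul_left ?_ (hNpos i)
    rw [hNa]
    linarith [hfcenter i]
  have hdual : ∀ i z, dist z (M.c i) < ρ →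
      ∑ q, max (a q.1 - dist z (x q)) 0 = n * γ + f i (x (s i)) - f i z := by
    intro i z hz
    rw [M.sum_max_sub_dist_of_near (ρ := ρ) hball (by linarith [hr i, hle_a i])
      (fun j hj => by linarith [hD i j hj, ha_le j]) hz.le, hNa]
  refine exactRecovery_of_dual _ _ s hs1 (fun q => a q.1) (n * γ) ?_ ?_ ?_ ?_
  · intro q
    have h1 := Metric.mem_closedBall.1 (hball q)
    have h2 := dist_triangle_right (x (s q.1)) (x q) (M.c q.1)
    linarith [hs2 q.1, hr q.1, hle_a q.1]
  · intro i q hiq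
    have h1 := Metric.mem_closedBall.1 (hball q)
    have h2 := dist_triangle4 (M.c q.1) (x q) (x (s i)) (M.c i)
    rw [dist_comm (M.c q.1) (x q), dist_comm (x q) (x (s i))] at h2
    linarith [hs2 i, hD i q.1 hiq.symm, ha_le q.1]
  · intro i
    rw [hdual i _ (hs2 i)]; ring
  · intro p hp
    rcases lt_or_ge (dist (x p) (M.c p.1)) ρ with hnear_p | hfar_p
    · rw [hdual p.1 _ hnear_p]
      have h1 : f p.1 (x (s p.1)) ≠ f p.1 (x p) := fun h =>
        hp p.1 (hinj p.1 (by simp [hs1]) (by simp) h)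
      have h2 := lt_of_le_of_ne (hsmin p.1 p rfl hnear_p) h1
      linarith
    · have h1 := hfar p.1 _ (hball p) hfar_p
      have h2 : ∑ q, max (a q.1 - dist (x p) (x q)) 0 ≤
          contribution α x (x p) + ∑ q : (Σ i : Fin k, Fin (N i)), 2 * ε := by
        rw [contribution_eq_sum, ← Finset.sum_add_distrib]
        refine Finset.sum_le_sum fun q _ => ?_
        refine max_le ?_ (add_nonneg (le_max_right _ _) (by linarith))
        linarith [ha_le q.1, le_max_left (α q.1 - dist (x p) (x q)) 0]
      rw [M.sum_card_eq hN fun _ => 2 * ε, ← Finset.sum_mul] at h2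
      have h3 := mul_lt_mul_of_pos_right hεκ hn'
      linarith

/-- Exact recovery in terms of the conditions `r i < α i < D i`, where the common value
`β i * (α i - E i) = γ` is the one of `G α` at all the centers. -/
theorem withHighProbability_exactRecovery (hpos : ∀ i, M.PositiveNearCenter i)
    (hac : ∀ i, (M.μ i).AbsolutelyContinuous volume) {γ : ℝ} {α : Fin k → ℝ}
    (hr : ∀ i, M.r i < α i) (hD : ∀ i j, j ≠ i → α j < dist (M.c j) (M.c i) - M.r j)
    (hγ : ∀ i, M.β i * (α i - M.E i) = γ)
    (hG : ∀ i, ∀ z ∈ Metric.closedBall (M.c i) (M.r i), z ≠ M.c i → M.G α z < M.G α (M.c i))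
    (hm : 1 ≤ m) :
    M.WithHighProbability fun _ N x => (m = 1 → ∀ i, Odd (N i)) →
      ExactRecovery k (fun p q => dist (x p) (x q)) Sigma.fst := by
  have hGc : ∀ i, M.G α (M.c i) = γ := fun i => by
    rw [M.G_center α i (hr i).le fun j hj => (hD i j hj).le, hγ]
  obtain ⟨ρ, hρ, hrρ, hDρ⟩ : ∃ ρ : ℝ, 0 < ρ ∧ (∀ i, M.r i + 4 * ρ ≤ α i) ∧
      ∀ i j, j ≠ i → α j + 4 * ρ ≤ dist (M.c j) (M.c i) - M.r j := by
    have h1 : ∀ᶠ ρ : ℝ in nhdsWithin 0 (Set.Ioi 0), (∀ i, M.r i + 4 * ρ < α i) ∧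
        ∀ i j, j ≠ i → α j + 4 * ρ < dist (M.c j) (M.c i) - M.r j := by
      refine nhdsWithin_le_nhds (Filter.Eventually.and ?_ ?_)
      · refine eventually_all.2 fun i => ?_
        exact ContinuousAt.eventually_lt (by fun_prop) (by fun_prop) (by simpa using hr i)
      · refine eventually_all.2 fun i => eventually_all.2 fun j => ?_
        by_cases hj : j = i
        · exact Eventually.of_forall fun _ h => absurd hj h
        · have : ∀ᶠ ρ : ℝ in nhds 0, α j + 4 * ρ < dist (M.c j) (M.c i) - M.r j :=
            ContinuousAt.eventually_lt (by fun_prop) (by fun_prop) (by simpa using hD i j hj)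
          filter_upwards [this] with ρ h _ using h
    obtain ⟨ρ, ⟨h2, h3⟩, h4⟩ := (h1.and self_mem_nhdsWithin).exists
    exact ⟨ρ, h4, fun i => (h2 i).le, fun i j hj => (h3 i j hj).le⟩
  -- The part of the balls away from their centers, where `G α` stays below `γ` by a margin `κ`.
  set K : Set (EuclideanSpace ℝ (Fin m)) :=
    ⋃ i, Metric.closedBall (M.c i) (M.r i) ∩ {z | ρ ≤ dist z (M.c i)} with hKdef
  have hK : IsCompact K := isCompact_iUnion fun i =>
    (isCompact_closedBall _ _).inter_right (isClosed_le continuous_const (by fun_prop))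
  have hKlt : ∀ z ∈ K, M.G α z < γ := by
    intro z hz
    obtain ⟨i, hz1, hz2⟩ := Set.mem_iUnion.1 hz
    rw [← hGc i]
    refine hG i z hz1 fun h => ?_
    subst h
    rw [Set.mem_ofPred_eq, dist_self] at hz2
    exact hρ.not_ge hz2
  obtain ⟨κ, hκ, hKκ⟩ : ∃ κ : ℝ, 0 < κ ∧ ∀ z ∈ K, M.G α z ≤ γ - κ := by
    rcases K.eq_empty_or_nonempty with he | hne
    · exact ⟨1, one_pos, by simp [he]⟩
    · obtain ⟨z₀, hz₀, hmax⟩ := hK.exists_isMaxOn hne (M.continuous_G α).continuousOn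
      exact ⟨γ - M.G α z₀, sub_pos.2 (hKlt z₀ hz₀), fun z hz => by
        rw [sub_sub_cancel]; exact hmax hz⟩
  have hB : 0 ≤ ∑ i, M.β i :=
    Finset.sum_nonneg fun i _ => zero_le_one.trans (M.one_le_β i)
  obtain ⟨ε, hε, hερ, hεκ⟩ : ∃ ε : ℝ, 0 < ε ∧ 2 * ε ≤ ρ ∧ (∑ i, M.β i) * (2 * ε) < κ / 2 := by
    refine ⟨min (ρ / 2) (κ / (4 * (∑ i, M.β i + 1))), by positivity, ?_, ?_⟩
    · linarith [min_le_left (ρ / 2) (κ / (4 * (∑ i, M.β i + 1)))]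
    · set e := min (ρ / 2) (κ / (4 * (∑ i, M.β i + 1))) with he
      have he0 : 0 < e := by positivity
      have h1 : e * (4 * (∑ i, M.β i + 1)) ≤ κ :=
        (le_div_iff₀ (by positivity)).1 (min_le_right _ _)
      linarith
  have hae : M.WithHighProbability fun _ N x =>
      (∀ q, x q ∈ Metric.closedBall (M.c q.1) (M.r q.1)) ∧
      ∀ i, (1 ≤ m ∧ Odd (N i) ∨ 2 ≤ m ∧ 3 ≤ N i) →
        Set.InjOn (fun p => ∑ q with q.1 = i, dist (x p) (x q))
          (Finset.univ.filter fun q : (Σ i : Fin k, Fin (N i)) => q.1 = i) := by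
    refine WithHighProbability.of_ae fun N => ?_
    have h1 : ∀ᵐ x ∂M.sampleLaw N, ∀ i, (1 ≤ m ∧ Odd (N i) ∨ 2 ≤ m ∧ 3 ≤ N i) →
        Set.InjOn (fun p => ∑ q with q.1 = i, dist (x p) (x q))
          (Finset.univ.filter fun q : (Σ i : Fin k, Fin (N i)) => q.1 = i) := by
      refine ae_all_iff.2 fun i => ?_
      by_cases hc : 1 ≤ m ∧ Odd (N i) ∨ 2 ≤ m ∧ 3 ≤ N i
      · have := ae_injOn_sum_dist volume (fun p : (Σ i : Fin k, Fin (N i)) => M.μ p.1)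
          (fun p => hac p.1) (Finset.univ.filter fun q => q.1 = i)
          (by rwa [finrank_euclideanSpace_fin, card_filter_fst_eq])
        filter_upwards [this] with x hx _ using hx
      · exact Eventually.of_forall fun _ h => absurd h hc
    filter_upwards [M.ae_sampleLaw_mem_ball N, h1] with x hx1 hx2 _ using ⟨hx1, hx2⟩
  have hnear := WithHighProbability.forall_finset Finset.univ fun i _ =>
    M.withHighProbability_exists_near_center i (hpos i) hε
  have hcenter := WithHighProbability.forall_finset Finset.univ fun i _ =>
    M.withHighProbability_contribution α (M.c i) hε
  have hfar := M.withHighProbability_contribution_le α hK hκ hKκ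
  refine (((hae.and hnear).and hcenter).and hfar).mono ?_
  filter_upwards [eventually_ge_atTop 3] with n hn N hN x hx hodd
  obtain ⟨⟨⟨⟨hx1, hx2⟩, hx3⟩, hx4⟩, hx5⟩ := hx
  have hNn : ∀ i, n ≤ N i := fun i => by
    have : (n : ℝ) ≤ N i := by
      rw [hN]; exact le_mul_of_one_le_left (Nat.cast_nonneg n) (M.one_le_β i)
    exact_mod_cast this
  refine M.exactRecovery_of_concentration (γ := γ) (by omega) hN hρ hε hερ hεκ hrρ hDρ hx1
    (fun i => hx3 i (Finset.mem_univ i)) (fun i => ?_) (fun i z hz hzρ => ?_) (fun i => hx2 i ?_)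
  · have := hx4 i (Finset.mem_univ i)
    rwa [hGc] at this
  · exact hx5 z (Set.mem_iUnion.2 ⟨i, hz, hzρ⟩)
  · rcases hm.eq_or_lt with h | h
    · exact Or.inl ⟨hm, hodd h.symm i⟩
    · exact Or.inr ⟨h, hn.trans (hNn i)⟩

theorem lt_dist_sub_of_lt_D {γ : ℝ} {i j : Fin k} (hj : j ≠ i)
    (h : (γ : EReal) < (M.β i : EReal) * (M.D i - (M.E i : EReal))) :
    M.E i + γ / M.β i < dist (M.c i) (M.c j) - M.r i := by
  have hβ : 0 < M.β i := zero_lt_one.trans_le (M.one_le_β i)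
  have h1 : M.D i ≤ ((dist (M.c i) (M.c j) - M.r i : ℝ) : EReal) :=
    iInf_le (fun j : {j : Fin k // j ≠ i} =>
      ((dist (M.c i) (M.c j) - M.r i : ℝ) : EReal)) ⟨j, hj⟩
  have h2 := h.trans_le (mul_le_mul_of_nonneg_left (EReal.sub_le_sub h1 le_rfl)
    (EReal.coe_nonneg.2 hβ.le))
  rw [← EReal.coe_sub, ← EReal.coe_mul, EReal.coe_lt_coe_iff] at h2
  rw [← lt_sub_iff_add_lt', div_lt_iff₀' hβ]
  exact h2

end ESBM

end KMedian


theorem mainTheorem2 {k m : ℕ} (hm : 1 ≤ m) (M : KMedian.ESBM k m)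
    (hrot : ∀ i, M.RotationInvariant i)
    (hpos : ∀ i, M.PositiveNearCenter i)
    (hac : ∀ i, (M.μ i).AbsolutelyContinuous MeasureTheory.volume)
    (γ : ℝ)
    (hγ_lower : ∀ i, M.β i * (M.r i - M.E i) < γ)
    (hγ_upper : ∀ i, (γ : EReal) < (M.β i : EReal) * (M.D i - (M.E i : EReal)))
    (α : Fin k → ℝ) (hα : ∀ i, α i = M.E i + γ / M.β i)
    (hG : ∀ i, ∀ z ∈ Metric.closedBall (M.c i) (M.r i), z ≠ M.c i → M.G α z < M.G α (M.c i)) :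
    ∀ δ : ℝ, 0 < δ → δ < 1 → ∃ n₀ : ℕ, ∀ n : ℕ, n₀ < n →
      ∀ N : Fin k → ℕ, (∀ i, (N i : ℝ) = M.β i * n) → (m = 1 → ∀ i, Odd (N i)) →
        1 - δ < (M.sampleLaw N).real
          {x | KMedian.ExactRecovery k (fun p q => dist (x p) (x q)) Sigma.fst} := by
  intro δ hδ _
  have hβ : ∀ i, 0 < M.β i := fun i => zero_lt_one.trans_le (M.one_le_β i)
  have hwhp := M.withHighProbability_exactRecovery hpos hac (γ := γ) (α := α)
    (fun i => by
      rw [hα, ← sub_lt_iff_lt_add', lt_div_iff₀' (hβ i)]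
      exact hγ_lower i)
    (fun i j hj => by
      rw [hα]
      exact M.lt_dist_sub_of_lt_D hj.symm (hγ_upper j))
    (fun i => by
      rw [hα]
      have := (hβ i).ne'
      field_simp
      ring) hG hm
  obtain ⟨n₀, hn₀⟩ := Filter.eventually_atTop.1 (hwhp (δ / 2) (by linarith))
  refine ⟨n₀, fun n hn N hN hodd => ?_⟩
  have h1 := hn₀ n hn.le N hN
  set R := {x : (Σ i : Fin k, Fin (N i)) → EuclideanSpace ℝ (Fin m) |
    KMedian.ExactRecovery k (fun p q => dist (x p) (x q)) Sigma.fst}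
  have h2 : (M.sampleLaw N).real Rᶜ ≤ δ / 2 :=
    ENNReal.toReal_le_of_le_ofReal (by linarith)
      ((MeasureTheory.measure_mono fun x (hx : x ∉ R) =>
        Set.mem_ofPred.2 fun h => hx (h hodd)).trans h1)
  have h3 := MeasureTheory.measureReal_union_le (μ := M.sampleLaw N) R Rᶜ
  rw [Set.union_compl_self, MeasureTheory.probReal_univ] at h3
  linarith
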